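/- Small base stations (SBSs), each covering a disc of fixed radius $R>0$, are placed in the cells of a hexagonal cellular grid so that adjacent SBSs are at distance $2Rc$, where $c\in[1/\sqrt3,1]$; that is, the SBS in the cell $(a,b)\in\mathbb Z^2$ is at $2Rc\,\big(a+\tfrac b2,\tfrac{\sqrt3}{2}b\big)$. The grid is either (i) an arbitrarily large finite patch: one SBS in each cell of a nonempty finite set of cells in which every cell has an adjacent cell; or (ii) the infinite grid without boundary, taken periodically: one SBS in every cell, SBSs whose cells differ by a multiple of $N\ge 2$ in each coordinate being identified, and areas being measured in one period (a fundamental parallelogram). For a nonempty set $F$ of SBSs let $\Omega_F$ be the region of points covered by exactly the SBSs in $F$. At the hour $t$ let $u^t$ be the user density, $U_F=\int_{\Omega_F}u^t$, $U^{i}=\sum_{F\ni i}U_F$ and $U_{sum}=\sum_F U_F$. Finitely many providers $l$ have finitely many contents $(l,k)$ with popularities $\phi_{l,k}\ge 0$, $\phi_{sum}=\sum_{l,k}\phi_{l,k}>0$; the content $(l,k)$ is cut into finitely many (at least one) blocks of sizes $S_{l,k,n}>0$, with $S_{l,k}=\sum_n S_{l,k,n}$. A caching allocation is given by $\gamma^{i}_{l,k,n}\in\{0,1\}$,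 which is $1$ if the block $(l,k,n)$ is cached in the SBS $i$ at the hour $t$. With $\theta_{back}=\beta_1U_{sum}$ and $\theta^{i}_{down}=\beta_2U^{i}$, the delay of a request for $(l,k)$ in $\Omega_F$ and the average delay are $$\theta^{F}_{l,k}=\sum_n\frac{S_{l,k,n}}{S_{l,k}}\min_{i\in F}\big[\theta^{i}_{down}+(1-\gamma^{i}_{l,k,n})\theta_{back}\big]+\beta_3|F|,\qquad D(t)=\frac{1}{\phi_{sum}U_{sum}}\sum_{l,k,F}\theta^{F}_{l,k}\,U_F\,\phi_{l,k}.$$ The overlapping percentage is $O=\big(\sum_iA_i-A_{total}\big)/A_{total}$, where $A_i$ is the area covered by the SBS $i$ and $A_{total}$ is the area covered by all SBSs together. Assume that the user density is uniform ($u^t\equiv\rho>0$), that the choosing delay is zero ($\beta_3=0$), and that $\beta_1>0$, $\beta_2\ge0$. Fix $R$, the cells, the contents, the popularities and the caching allocation, and let only $c$ vary in $[1/\sqrt3,1]$. Then no region of positive area is covered by four or more SBSs; $O$ is strictly decreasing in $c$; and the average delay $D(t)$ decreases as the overlapping percentage increases (equivalently, as $c$ decreases): $D(t)$ is a nondecreasing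 function of $c$, and if $O$ is greater for $c'$ than for $c$, then $D(t)$ is at most as great for $c'$ as for $c$. If some block of some content of positive popularity is missing in the cache of some SBS at the hour $t$, then both are strict: $D(t)$ is strictly increasing in $c$, and strictly smaller for the greater $O$. -/

import Mathlib

open MeasureTheory Set

noncomputable section

namespace SmallCell

/-- The two-dimensional area in which the small-cell base stations (SBSs) and the users live. -/
abbrev Plane := EuclideanSpace ℝ (Fin 2)

/-! ### The caching model, for arbitrary coverage regions -/

/-- The contents of the service providers. Provider `l` owns the contents `(l, k)`, and the content
`(l, k)` is cut into the blocks `(l, k, n)`. -/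
structure Catalogue where
  /-- the number of service providers -/
  L : ℕ
  /-- the number of contents of a provider -/
  K : Fin L → ℕ
  /-- the number of blocks of a content -/
  N : (l : Fin L) → Fin (K l) → ℕ
  N_pos : ∀ l k, 0 < N l k
  /-- the size of a block -/
  blockSize : (l : Fin L) → (k : Fin (K l)) → Fin (N l k) → ℝ
  blockSize_pos : ∀ l k n, 0 < blockSize l k n

/-- The size of a content is the total size of its blocks. -/
def Catalogue.size (C : Catalogue) (l : Fin C.L) (k : Fin (C.K l)) : ℝ :=
  ∑ n, C.blockSize l k n

/-- The remaining numerical data: the coefficients of the backhaul delay, of the downlink delay and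
of the choosing delay, the user density at each hour and location, and the popularity of each
content at each hour. -/
structure Params (C : Catalogue) where
  β₁ : ℝ
  β₂ : ℝ
  β₃ : ℝ
  density : ℕ → Plane → ℝ
  popularity : ℕ → (l : Fin C.L) → Fin (C.K l) → ℝ

/-- A caching allocation: whether, at hour `t`, the SBS `i` has the block `(l, k, n)` in its
cache. -/
abbrev Allocation (C : Catalogue) (S : Type) :=
  ℕ → S → (l : Fin C.L) → (k : Fin (C.K l)) → Fin (C.N l k) → Bool

section Model

variable {S : Type} [Fintype S] {C : Catalogue}

/-- The simplest region with covering set `F`: the users that are covered by the SBSs in `F` and by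
no other ones. -/
def simplestRegion (cov : S → Set Plane) (F : Finset S) : Set Plane :=
  {x | ∀ i, x ∈ cov i ↔ i ∈ F}

/-- The covering sets that index the simplest regions. (If no point has the covering set `F`, the
region is empty and contributes nothing.) -/
def regionIndices (S : Type) [Fintype S] : Finset (Finset S) :=
  Finset.univ.filter fun F => F.Nonempty

/-- The number of users in a simplest region. -/
def regionUsers (P : Params C) (cov : S → Set Plane) (t : ℕ) (F : Finset S) : ℝ :=
  ∫ x in simplestRegion cov F, P.density t x

open Classical in
/-- The number of users under the SBS `i`. -/
def stationUsers (P : Params C) (cov : S → Set Plane) (t : ℕ) (i : S) : ℝ :=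
  ∑ F ∈ (regionIndices S).filter (fun F => i ∈ F), regionUsers P cov t F

/-- The total number of users. -/
def totalUsers (P : Params C) (cov : S → Set Plane) (t : ℕ) : ℝ :=
  ∑ F ∈ regionIndices S, regionUsers P cov t F

/-- The sum of all popularities. -/
def totalPopularity (P : Params C) (t : ℕ) : ℝ :=
  ∑ l, ∑ k, P.popularity t l k

/-- The delay of the backhaul link, proportional to the total number of users. -/
def backhaulDelay (P : Params C) (cov : S → Set Plane) (t : ℕ) : ℝ :=
  P.β₁ * totalUsers P cov t

/-- The delay of the downlink of an SBS, proportional to the number of users it covers. -/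
def downlinkDelay (P : Params C) (cov : S → Set Plane) (t : ℕ) (i : S) : ℝ :=
  P.β₂ * stationUsers P cov t i

/-- The choosing delay in a simplest region, proportional to the number of available SBSs. -/
def choosingDelay (P : Params C) (F : Finset S) : ℝ :=
  P.β₃ * F.card

/-- The delay for a block when it is downloaded from the SBS `i`. -/
def blockDelay (P : Params C) (cov : S → Set Plane) (γ : Allocation C S) (t : ℕ)
    (l : Fin C.L) (k : Fin (C.K l)) (n : Fin (C.N l k)) (i : S) : ℝ :=
  downlinkDelay P cov t i + (1 - if γ t i l k n then 1 else 0) * backhaulDelay P cov t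

/-- The delay for a user with covering set `F` who requests the content `(l, k)`: each block comes
from the SBS in `F` with the lowest delay. (The value for `F = ∅` is never used.) -/
def requestDelay (P : Params C) (cov : S → Set Plane) (γ : Allocation C S) (t : ℕ)
    (F : Finset S) (l : Fin C.L) (k : Fin (C.K l)) : ℝ :=
  (∑ n, C.blockSize l k n / C.size l k *
      (if h : F.Nonempty then F.inf' h (blockDelay P cov γ t l k n) else 0))
    + choosingDelay P F

/-- The average delay `D(t)` of the content requests at hour `t`. -/
def averageDelay (P : Params C) (cov : S → Set Plane) (γ : Allocation C S) (t : ℕ) : ℝ :=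
  1 / (totalPopularity P t * totalUsers P cov t) *
    ∑ l, ∑ k, ∑ F ∈ regionIndices S,
      requestDelay P cov γ t F l k * regionUsers P cov t F * P.popularity t l k

/-- The overlapping percentage: the sum of the areas covered by the single SBSs, minus the total
covered area, divided by the total covered area. -/
def overlapPercentage (cov : S → Set Plane) : ℝ :=
  ((∑ i, volume.real (cov i)) - volume.real (⋃ i, cov i)) / volume.real (⋃ i, cov i)

end Model

/-! ### The hexagonal cellular grid -/

/-- The point with coordinates `(a, b)` with respect to the unit vectors `(1, 0)` and
`(1/2, √3/2)`. At integer coordinates these are the centres of the cells of a honeycomb, with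
distance `1` between the centres of adjacent cells. -/
def hexPoint (a b : ℝ) : Plane := !₂[a + b / 2, √3 / 2 * b]

/-- Two cells of the honeycomb are adjacent. -/
def Adjacent (p q : ℤ × ℤ) : Prop := dist (hexPoint p.1 p.2) (hexPoint q.1 q.2) = 1

/-- The coverage disc of radius `R` of the SBS in the cell `p`, in the grid in which adjacent SBSs
have the distance `2 * R * c`. -/
def disc (R c : ℝ) (p : ℤ × ℤ) : Set Plane :=
  Metric.closedBall ((2 * R * c) • hexPoint p.1 p.2) R

/-- The two rigorous forms of an "approximately infinite" hexagonal grid of SBSs.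
* `patch T`: one SBS in each of the cells of a finite set `T`, which can be as large as one likes.
  No SBS is isolated.
* `periodic N`: one SBS in every cell of the infinite honeycomb, where SBSs whose cells differ by a
  multiple of `N` in each coordinate are identified. There is no boundary. -/
inductive HexGrid where
  | patch (T : Finset (ℤ × ℤ)) (nonempty : T.Nonempty)
      (no_isolated : ∀ p ∈ T, ∃ q ∈ T, Adjacent p q) : HexGrid
  | periodic (N : ℕ) (two_le : 2 ≤ N) : HexGrid

/-- The SBSs of a grid. They do not depend on the distance between adjacent ones. -/
def HexGrid.Station : HexGrid → Type
  | .patch T _ _ => {p // p ∈ T}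
  | .periodic N _ => Fin N × Fin N

instance (G : HexGrid) : Fintype G.Station :=
  match G with
  | .patch T _ _ => inferInstanceAs (Fintype {p // p ∈ T})
  | .periodic N _ => inferInstanceAs (Fintype (Fin N × Fin N))

/-- A fundamental parallelogram for the translations of the grid by multiples of `N` cells. -/
def periodCell (R c : ℝ) (N : ℕ) : Set Plane :=
  {x | ∃ a ∈ Ico (0 : ℝ) N, ∃ b ∈ Ico (0 : ℝ) N, x = (2 * R * c) • hexPoint a b}

/-- The coverage regions of the SBSs. In the periodic grid an SBS covers the discs around all the
cells it stands for, and areas are measured within one period. -/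
def HexGrid.coverage (R c : ℝ) : (G : HexGrid) → G.Station → Set Plane
  | .patch _ _ _ => fun p => disc R c p.1
  | .periodic N _ => fun p =>
      periodCell R c N ∩ ⋃ k : ℤ × ℤ, disc R c ((p.1 : ℤ) + N * k.1, (p.2 : ℤ) + N * k.2)

end SmallCell

end

/-! With uniform density all SBSs cover equal areas, so all downlink delays agree. The minimum over
a covering set then depends only on whether some SBS in it caches the block. Hence $D(t)$ is a
constant plus a nonnegative combination of the areas of `uncovered cov Γ`, with $Γ$ the set of SBSs
caching a given block (`averageDelay_eq`). The sum of the single areas is also constant, so $O$ is a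
decreasing function of the total area, the case $Γ=∅$. It remains to show that every such area grows
with $c$.

Divide the uncovered region according to the nearest uncached centre and translate each piece so
that its centre is the origin. The piece becomes `localCell`: the points of the disc of radius $R$
that lie in certain half-planes, one for each uncached cell, and outside certain discs, one for each
cached cell. In this frame every constraint relaxes as $c$ grows (`localCell_mono`), although the
pieces themselves move apart. An adjacent cell, cached or not, makes the growth strict
(`exists_eventually_mem_localCell`).

Patches and periodic grids are treated together as a `Layout` with a group of shifts, trivial for a
patch. Unfolding a fundamental domain turns areas in one period into areas of full local cells
(`IsWindow.tsum_volume`, `Layout.volume_uncovered`).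

Fourfold coverage is negligible because two of any four lattice cells are at least second
neighbours, and $c\ge 1/\sqrt3$ makes their discs at most tangent. -/

noncomputable section

namespace SmallCell

open Filter Topology
open scoped RealInnerProductSpace

/-! ### Uniform density: from delays to uncovered areas. -/

section UniformModel

variable {S : Type} {C : Catalogue}

/-- The points that are covered by some SBS, but by none of the SBSs in `Γ`. -/
def uncovered (cov : S → Set Plane) (Γ : Set S) : Set Plane :=
  {x | (∃ i, x ∈ cov i) ∧ ∀ i ∈ Γ, x ∉ cov i}

lemma uncovered_empty (cov : S → Set Plane) : uncovered cov ∅ = ⋃ i, cov i := by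
  ext x; simp [uncovered]

lemma measurableSet_simplestRegion [Finite S] {cov : S → Set Plane}
    (hm : ∀ i, MeasurableSet (cov i)) (F : Finset S) : MeasurableSet (simplestRegion cov F) := by
  have : simplestRegion cov F = ⋂ i, {x | x ∈ cov i ↔ i ∈ F} := by
    ext x; simp [simplestRegion]
  rw [this]
  refine MeasurableSet.iInter fun i => ?_
  by_cases h : i ∈ F
  · simpa [h] using hm i
  · have : {x | x ∈ cov i ↔ i ∈ F} = (cov i)ᶜ := by ext x; simp [h]
    exact this ▸ (hm i).compl

lemma simplestRegion_disjoint (cov : S → Set Plane) {F F' : Finset S} (h : F ≠ F') :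
    Disjoint (simplestRegion cov F) (simplestRegion cov F') := by
  rw [Set.disjoint_left]
  intro x hx hx'
  exact h (Finset.ext fun i => (hx i).symm.trans (hx' i))

lemma volume_simplestRegion_ne_top {cov : S → Set Plane} (hfin : ∀ i, volume (cov i) ≠ ⊤)
    {F : Finset S} (hF : F.Nonempty) : volume (simplestRegion cov F) ≠ ⊤ := by
  obtain ⟨i, hi⟩ := hF
  exact measure_ne_top_of_subset (fun x hx => (hx i).2 hi) (hfin i)

variable {P : Params C} {cov : S → Set Plane} {t : ℕ} {ρ a : ℝ}

lemma regionUsers_eq (hu : ∀ x, P.density t x = ρ) (F : Finset S) :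
    regionUsers P cov t F = ρ * volume.real (simplestRegion cov F) := by
  simp [regionUsers, hu, mul_comm]

variable [Fintype S]

/-- Simplest regions are pairwise disjoint, so their areas add up. Restricting to nonempty covering
sets keeps the areas finite. -/
lemma sum_volume_simplestRegion {cov : S → Set Plane} (hm : ∀ i, MeasurableSet (cov i))
    (hfin : ∀ i, volume (cov i) ≠ ⊤) (Q : Finset S → Prop) [DecidablePred Q] :
    ∑ F ∈ (regionIndices S).filter Q, volume.real (simplestRegion cov F) =
      volume.real {x | ∃ F : Finset S, F.Nonempty ∧ Q F ∧ x ∈ simplestRegion cov F} := by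
  rw [← measureReal_biUnion_finset (fun F _ F' _ h => simplestRegion_disjoint cov h)
    (fun F _ => measurableSet_simplestRegion hm F)
    (fun F hF => volume_simplestRegion_ne_top hfin (by
      simp only [regionIndices, Finset.mem_filter] at hF; exact hF.1.2))]
  congr 1
  ext x
  simp [regionIndices, and_assoc]

lemma exists_mem_simplestRegion (cov : S → Set Plane) (x : Plane) :
    ∃ F : Finset S, x ∈ simplestRegion cov F := by
  classical
  exact ⟨Finset.univ.filter fun i => x ∈ cov i, fun i => by simp⟩

lemma stationUsers_eq (hu : ∀ x, P.density t x = ρ) (hm : ∀ i, MeasurableSet (cov i))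
    (hfin : ∀ i, volume (cov i) ≠ ⊤) (i : S) :
    stationUsers P cov t i = ρ * volume.real (cov i) := by
  classical
  simp only [stationUsers, regionUsers_eq hu]
  rw [← Finset.mul_sum, sum_volume_simplestRegion hm hfin]
  congr 2
  ext x
  obtain ⟨F, hF⟩ := exists_mem_simplestRegion cov x
  constructor
  · rintro ⟨F', -, h, hx⟩
    exact (hx i).2 h
  · intro h
    exact ⟨F, ⟨i, (hF i).1 h⟩, (hF i).1 h, hF⟩

/-- If $Γ$ consists of the SBSs caching a block, these are the users who must fetch it through the
backhaul. -/
lemma sum_regionUsers_eq (hu : ∀ x, P.density t x = ρ) (hm : ∀ i, MeasurableSet (cov i))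
    (hfin : ∀ i, volume (cov i) ≠ ⊤) (Γ : Set S) [DecidablePred fun F : Finset S => ∀ i ∈ F, i ∉ Γ] :
    ∑ F ∈ (regionIndices S).filter (fun F => ∀ i ∈ F, i ∉ Γ), regionUsers P cov t F =
      ρ * volume.real (uncovered cov Γ) := by
  simp only [regionUsers_eq hu]
  rw [← Finset.mul_sum, sum_volume_simplestRegion hm hfin]
  congr 2
  ext x
  obtain ⟨F, hF⟩ := exists_mem_simplestRegion cov x
  constructor
  · rintro ⟨F', ⟨j, hj⟩, h, hx⟩
    exact ⟨⟨j, (hx j).2 hj⟩, fun i hi hxi => h i ((hx i).1 hxi) hi⟩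
  · rintro ⟨⟨j, hj⟩, h⟩
    exact ⟨F, ⟨j, (hF j).1 hj⟩, fun i hi hiΓ => h i hiΓ ((hF i).2 hi), hF⟩

lemma totalUsers_eq (hu : ∀ x, P.density t x = ρ) (hm : ∀ i, MeasurableSet (cov i))
    (hfin : ∀ i, volume (cov i) ≠ ⊤) :
    totalUsers P cov t = ρ * volume.real (uncovered cov ∅) := by
  classical
  rw [← sum_regionUsers_eq hu hm hfin, totalUsers]
  congr 1
  simp

lemma sum_blockSize_div (C : Catalogue) (l : Fin C.L) (k : Fin (C.K l)) :
    ∑ n, C.blockSize l k n / C.size l k = 1 := by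
  have : Nonempty (Fin (C.N l k)) := ⟨⟨0, C.N_pos l k⟩⟩
  rw [← Finset.sum_div]
  exact div_self (Finset.sum_pos (fun n _ => C.blockSize_pos l k n) Finset.univ_nonempty).ne'

lemma size_pos (C : Catalogue) (l : Fin C.L) (k : Fin (C.K l)) : 0 < C.size l k := by
  have : Nonempty (Fin (C.N l k)) := ⟨⟨0, C.N_pos l k⟩⟩
  exact Finset.sum_pos (fun n _ => C.blockSize_pos l k n) Finset.univ_nonempty

-- With equal downlink delays, the best SBS costs $θ$ if one in $F$ caches the block, and $θ$ plus
-- the backhaul delay otherwise. The block weights sum to 1, which pulls $θ$ out.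
open Classical in
lemma requestDelay_eq (γ : Allocation C S) (hβ₃ : P.β₃ = 0) {θ : ℝ}
    (hθ : ∀ i, downlinkDelay P cov t i = θ) (hB : 0 ≤ backhaulDelay P cov t)
    {F : Finset S} (hF : F.Nonempty) (l : Fin C.L) (k : Fin (C.K l)) :
    requestDelay P cov γ t F l k = θ + backhaulDelay P cov t *
      ∑ n, C.blockSize l k n / C.size l k *
        (if ∀ i ∈ F, i ∉ {i | γ t i l k n = true} then 1 else 0) := by
  have key : ∀ n, F.inf' hF (blockDelay P cov γ t l k n) = θ + backhaulDelay P cov t *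
      (if ∀ i ∈ F, i ∉ {i | γ t i l k n = true} then 1 else 0) := by
    intro n
    apply le_antisymm
    · rw [Finset.inf'_le_iff]
      split_ifs with h
      · obtain ⟨i, hi⟩ := hF
        refine ⟨i, hi, ?_⟩
        have := h i hi
        simp only [mem_ofPred_eq, Bool.not_eq_true] at this
        simp [blockDelay, hθ, this]
      · push Not at h
        obtain ⟨i, hi, h⟩ := h
        simp only [mem_ofPred_eq] at h
        exact ⟨i, hi, by simp [blockDelay, hθ, h]⟩
    · rw [Finset.le_inf'_iff]
      intro i hi
      split_ifs with h
      · have := h i hi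
        simp only [mem_ofPred_eq, Bool.not_eq_true] at this
        simp [blockDelay, hθ, this]
      · simp only [blockDelay, hθ, mul_zero]
        split_ifs <;> simp [hB]
  simp only [requestDelay, hF, dif_pos, key, choosingDelay, hβ₃, zero_mul, add_zero, mul_add,
    Finset.sum_add_distrib, ← Finset.sum_mul, sum_blockSize_div, one_mul, Finset.mul_sum]
  congr 1
  exact Finset.sum_congr rfl fun n _ => by ring

/-- With a uniform density and SBSs that cover equal areas, the average delay is an affine function
of the areas in which the single blocks are not available. -/
lemma averageDelay_eq (γ : Allocation C S) (hβ₁ : 0 ≤ P.β₁) (hβ₃ : P.β₃ = 0)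
    (hΦ : totalPopularity P t ≠ 0) (hρ : 0 < ρ) (hu : ∀ x, P.density t x = ρ)
    (hm : ∀ i, MeasurableSet (cov i)) (hfin : ∀ i, volume (cov i) ≠ ⊤)
    (ha : ∀ i, volume.real (cov i) = a) (hA : 0 < volume.real (uncovered cov ∅)) :
    averageDelay P cov γ t = P.β₂ * (ρ * a) + P.β₁ * ρ / totalPopularity P t *
      ∑ l, ∑ k, P.popularity t l k * ∑ n, C.blockSize l k n / C.size l k *
        volume.real (uncovered cov {i | γ t i l k n = true}) := by
  classical
  have hU : 0 < totalUsers P cov t := by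
    rw [totalUsers_eq hu hm hfin]; positivity
  have hθ : ∀ i, downlinkDelay P cov t i = P.β₂ * (ρ * a) := fun i => by
    rw [downlinkDelay, stationUsers_eq hu hm hfin, ha]
  have hB : 0 ≤ backhaulDelay P cov t := mul_nonneg hβ₁ hU.le
  -- The factor `totalUsers` in front cancels the normalization of the average. In the second
  -- summand it comes from the backhaul delay.
  have key : ∀ l k, ∑ F ∈ regionIndices S,
      requestDelay P cov γ t F l k * regionUsers P cov t F * P.popularity t l k =
      totalUsers P cov t * (P.popularity t l k * (P.β₂ * (ρ * a)) + P.β₁ * ρ *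
        (P.popularity t l k * ∑ n, C.blockSize l k n / C.size l k *
          volume.real (uncovered cov {i | γ t i l k n = true}))) := by
    intro l k
    have h1 : ∀ n, ∑ F ∈ regionIndices S,
        (if ∀ i ∈ F, i ∉ {i | γ t i l k n = true} then (1 : ℝ) else 0) * regionUsers P cov t F =
        ρ * volume.real (uncovered cov {i | γ t i l k n = true}) := by
      intro n
      rw [← sum_regionUsers_eq hu hm hfin, Finset.sum_filter]
      exact Finset.sum_congr rfl fun F _ => by rw [ite_mul, one_mul, zero_mul]
    calc _ = ∑ F ∈ regionIndices S, ((P.popularity t l k * (P.β₂ * (ρ * a))) * regionUsers P cov t F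
            + P.popularity t l k * backhaulDelay P cov t * ∑ n, C.blockSize l k n / C.size l k *
          ((if ∀ i ∈ F, i ∉ {i | γ t i l k n = true} then 1 else 0) * regionUsers P cov t F)) := by
          refine Finset.sum_congr rfl fun F hF => ?_
          rw [requestDelay_eq γ hβ₃ hθ hB (by simpa [regionIndices] using hF)]
          simp only [← mul_assoc, ← Finset.sum_mul]
          ring
      _ = _ := by
          rw [Finset.sum_add_distrib, ← Finset.mul_sum, ← Finset.mul_sum, Finset.sum_comm]
          simp only [← Finset.mul_sum, h1]
          simp only [mul_left_comm _ ρ, ← Finset.mul_sum]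
          rw [show ∑ F ∈ regionIndices S, regionUsers P cov t F = totalUsers P cov t from rfl,
            backhaulDelay]
          ring
  rw [averageDelay]
  simp only [key, ← Finset.mul_sum, Finset.sum_add_distrib, ← Finset.sum_mul]
  rw [show ∑ l, ∑ k, P.popularity t l k = totalPopularity P t from rfl]
  field_simp

/-- The conclusions on the overlapping percentage and on the average delay for a family of coverage
regions, in terms of the areas in which the single blocks are not available. -/
theorem delay_of_uncovered_mono {I : Set ℝ} {cov : ℝ → S → Set Plane}
    (hm : ∀ c ∈ I, ∀ i, MeasurableSet (cov c i)) (hfin : ∀ c ∈ I, ∀ i, volume (cov c i) ≠ ⊤)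
    (ha : ∀ c ∈ I, ∀ i, volume.real (cov c i) = a) (ha0 : 0 < a) [Nonempty S]
    (hmono : ∀ Γ : Set S, MonotoneOn (fun c => volume.real (uncovered (cov c) Γ)) I)
    (hstrict : ∀ Γ : Set S, (∃ i, i ∉ Γ) →
      StrictMonoOn (fun c => volume.real (uncovered (cov c) Γ)) I)
    (γ : Allocation C S) (hβ₁ : 0 < P.β₁) (hβ₃ : P.β₃ = 0)
    (hpop : ∀ l k, 0 ≤ P.popularity t l k) (hΦ : 0 < totalPopularity P t)
    (hρ : 0 < ρ) (hu : ∀ x, P.density t x = ρ) :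
    StrictAntiOn (fun c => overlapPercentage (cov c)) I ∧
    MonotoneOn (fun c => averageDelay P (cov c) γ t) I ∧
    ((∃ i l k n, 0 < P.popularity t l k ∧ γ t i l k n = false) →
      StrictMonoOn (fun c => averageDelay P (cov c) γ t) I) := by
  have hA : ∀ c ∈ I, 0 < volume.real (uncovered (cov c) ∅) := by
    intro c hc
    obtain ⟨i⟩ := ‹Nonempty S›
    refine ha0.trans_le ?_
    rw [← ha c hc i, uncovered_empty]
    refine measureReal_mono (subset_iUnion _ i) ?_
    exact ((measure_iUnion_fintype_le _ _).trans_lt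
      (ENNReal.sum_lt_top.2 fun j _ => (hfin c hc j).lt_top)).ne
  have hD : ∀ c ∈ I, averageDelay P (cov c) γ t = _ := fun c hc =>
    averageDelay_eq γ hβ₁.le hβ₃ hΦ.ne' hρ hu (hm c hc) (hfin c hc) (ha c hc) (hA c hc)
  have hw : ∀ l k n, 0 < C.blockSize l k n / C.size l k := fun l k n =>
    div_pos (C.blockSize_pos l k n) (size_pos C l k)
  have hle : ∀ {c c'}, c ∈ I → c' ∈ I → c ≤ c' → ∀ l k n, C.blockSize l k n / C.size l k *
        volume.real (uncovered (cov c) {i | γ t i l k n = true}) ≤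
      C.blockSize l k n / C.size l k *
        volume.real (uncovered (cov c') {i | γ t i l k n = true}) := fun hc hc' hcc l k n =>
    mul_le_mul_of_nonneg_left (hmono _ hc hc' hcc) (hw l k n).le
  have hle2 := fun {c c'} (hc : c ∈ I) (hc' : c' ∈ I) (hcc : c ≤ c') l k =>
    mul_le_mul_of_nonneg_left
      (Finset.sum_le_sum fun n (_ : n ∈ Finset.univ) => hle hc hc' hcc l k n) (hpop l k)
  have hc0 : 0 < P.β₁ * ρ / totalPopularity P t := by positivity
  refine ⟨?_, ?_, ?_⟩
  · intro c hc c' hc' hcc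
    -- For $Γ=∅$ the uncovered area is the total covered area $A$, and $O$ is a positive constant
    -- divided by $A$, minus 1.
    have h := hstrict ∅ (by simp) hc hc' hcc
    have h0 := hA c hc
    have h0' := hA c' hc'
    simp only [uncovered_empty] at h h0 h0'
    simp only [overlapPercentage, ha c hc, ha c' hc', sub_div, div_self h0.ne', div_self h0'.ne']
    have : 0 < ∑ _i : S, a := Finset.sum_pos (fun _ _ => ha0) Finset.univ_nonempty
    gcongr
  · intro c hc c' hc' hcc
    simp only [hD c hc, hD c' hc']
    refine add_le_add le_rfl (mul_le_mul_of_nonneg_left ?_ hc0.le)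
    exact Finset.sum_le_sum fun l _ => Finset.sum_le_sum fun k _ => hle2 hc hc' hcc l k
  · rintro ⟨i, l, k, n, hφ, hγ⟩ c hc c' hc' hcc
    simp only [hD c hc, hD c' hc']
    refine add_lt_add_of_le_of_lt le_rfl (mul_lt_mul_of_pos_left ?_ hc0)
    refine Finset.sum_lt_sum (fun l _ => Finset.sum_le_sum fun k _ => hle2 hc hc' hcc.le l k)
      ⟨l, Finset.mem_univ _, ?_⟩
    refine Finset.sum_lt_sum (fun k _ => hle2 hc hc' hcc.le l k) ⟨k, Finset.mem_univ _, ?_⟩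
    refine mul_lt_mul_of_pos_left ?_ hφ
    refine Finset.sum_lt_sum (fun n _ => hle hc hc' hcc.le l k n) ⟨n, Finset.mem_univ _, ?_⟩
    exact mul_lt_mul_of_pos_left (hstrict _ ⟨i, by simp [hγ]⟩ hc hc' hcc) (hw l k n)

end UniformModel

/-! ### The triangular lattice -/

/-- The centre of a cell in the honeycomb in which adjacent centres have distance `1`. -/
def latticePoint (q : ℤ × ℤ) : Plane := hexPoint q.1 q.2

/-- The squared distance of a cell from the origin. -/
def latticeNorm (q : ℤ × ℤ) : ℤ := q.1 ^ 2 + q.1 * q.2 + q.2 ^ 2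

lemma latticePoint_add (p q : ℤ × ℤ) :
    latticePoint (p + q) = latticePoint p + latticePoint q := by
  ext i
  fin_cases i <;> simp [latticePoint, hexPoint] <;> ring

lemma latticePoint_sub (p q : ℤ × ℤ) :
    latticePoint (p - q) = latticePoint p - latticePoint q := by
  ext i
  fin_cases i <;> simp [latticePoint, hexPoint] <;> ring

lemma latticePoint_zero : latticePoint 0 = 0 := by
  ext i
  fin_cases i <;> simp [latticePoint, hexPoint]

lemma norm_latticePoint_sq (q : ℤ × ℤ) : ‖latticePoint q‖ ^ 2 = latticeNorm q := by
  rw [EuclideanSpace.norm_sq_eq]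
  simp only [Fin.sum_univ_two, latticePoint, hexPoint, latticeNorm, Real.norm_eq_abs, sq_abs]
  have : √3 ^ 2 = 3 := Real.sq_sqrt (by norm_num)
  simp
  linear_combination (q.2 : ℝ) ^ 2 / 4 * this

lemma one_le_latticeNorm {q : ℤ × ℤ} (hq : q ≠ 0) : 1 ≤ latticeNorm q := by
  by_contra! h
  have h0 : latticeNorm q ≤ 0 := by omega
  unfold latticeNorm at h0
  have h2 : q.2 = 0 := by nlinarith [sq_nonneg (2 * q.1 + q.2), sq_nonneg q.2]
  have h1 : q.1 = 0 := by nlinarith [sq_nonneg (q.1 + 2 * q.2), sq_nonneg q.1]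
  exact hq (Prod.ext h1 h2)

lemma one_le_norm_latticePoint {q : ℤ × ℤ} (hq : q ≠ 0) : 1 ≤ ‖latticePoint q‖ := by
  have h : (1 : ℝ) ≤ ‖latticePoint q‖ ^ 2 := by
    rw [norm_latticePoint_sq]; exact_mod_cast one_le_latticeNorm hq
  nlinarith [norm_nonneg (latticePoint q)]

lemma finite_norm_latticePoint_le (M : ℝ) : {q : ℤ × ℤ | ‖latticePoint q‖ ≤ M}.Finite := by
  have key : ∀ a b : ℤ, ((a ^ 2 + a * b + b ^ 2 : ℤ) : ℝ) ≤ M ^ 2 → 0 ≤ M →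
      -⌈2 * M⌉ ≤ b ∧ b ≤ ⌈2 * M⌉ := by
    intro a b h hM
    push_cast at h
    have : |(b : ℝ)| ≤ 2 * M := abs_le_of_sq_le_sq (by nlinarith [sq_nonneg (2 * a + b : ℝ)])
      (by positivity)
    obtain ⟨h1, h2⟩ := abs_le.1 this
    have := Int.le_ceil (2 * M)
    constructor
    · have : (-⌈2 * M⌉ : ℝ) ≤ b := by linarith
      exact_mod_cast this
    · have : (b : ℝ) ≤ ⌈2 * M⌉ := by linarith
      exact_mod_cast this
  refine ((finite_Icc (-⌈2 * M⌉) ⌈2 * M⌉).prod (finite_Icc (-⌈2 * M⌉) ⌈2 * M⌉)).subset ?_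
  intro q hq
  have hM : 0 ≤ M := (norm_nonneg _).trans hq
  have h : (latticeNorm q : ℝ) ≤ M ^ 2 := by
    rw [← norm_latticePoint_sq]; exact pow_le_pow_left₀ (norm_nonneg _) hq 2
  unfold latticeNorm at h
  refine ⟨key q.2 q.1 ?_ hM, key q.1 q.2 h hM⟩
  rwa [show q.2 ^ 2 + q.2 * q.1 + q.1 ^ 2 = q.1 ^ 2 + q.1 * q.2 + q.2 ^ 2 by ring]

lemma finite_norm_sub_latticePoint_le {d : ℝ} (hd : 0 < d) (x : Plane) (r : ℝ) :
    {q : ℤ × ℤ | ‖x - d • latticePoint q‖ ≤ r}.Finite := by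
  refine (finite_norm_latticePoint_le ((r + ‖x‖) / d)).subset fun q hq => ?_
  have hq : ‖x - d • latticePoint q‖ ≤ r := hq
  change ‖latticePoint q‖ ≤ _
  rw [le_div_iff₀ hd]
  have h1 : ‖d • latticePoint q‖ = d * ‖latticePoint q‖ := by
    rw [norm_smul, Real.norm_of_nonneg hd.le]
  have h2 := norm_sub_norm_le (d • latticePoint q) x
  rw [norm_sub_rev] at h2
  nlinarith

/-- Nonzero lattice vectors of norm below 3 are the six unit vectors, and four points of the plane
cannot be pairwise at distance 1. -/
lemma exists_three_le_latticeNorm {q : Fin 4 → ℤ × ℤ} (hq : Function.Injective q) :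
    ∃ i j, 3 ≤ latticeNorm (q i - q j) := by
  by_contra! h
  have unit : ∀ w : ℤ × ℤ, w ≠ 0 → latticeNorm w < 3 →
      w = (1, 0) ∨ w = (-1, 0) ∨ w = (0, 1) ∨ w = (0, -1) ∨ w = (1, -1) ∨ w = (-1, 1) := by
    rintro ⟨a, b⟩ hw hn
    simp only [latticeNorm] at hn
    have ha : a ≤ 1 := by nlinarith [sq_nonneg (a + 2 * b)]
    have ha' : -1 ≤ a := by nlinarith [sq_nonneg (a + 2 * b)]
    have hb : b ≤ 1 := by nlinarith [sq_nonneg (2 * a + b)]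
    have hb' : -1 ≤ b := by nlinarith [sq_nonneg (2 * a + b)]
    interval_cases a <;> interval_cases b <;> simp_all
  have e : ∀ i j, i ≠ j → _ := fun i j hij => unit _ (sub_ne_zero.2 (hq.ne hij)) (h i j)
  have e1 := e 1 0 (by decide)
  have e2 := e 2 0 (by decide)
  have e3 := e 3 0 (by decide)
  have e21 := e 2 1 (by decide)
  have e31 := e 3 1 (by decide)
  have e32 := e 3 2 (by decide)
  simp only [Prod.ext_iff, Prod.fst_sub, Prod.snd_sub] at e1 e2 e3 e21 e31 e32
  omega

/-! ### The part of a disc that belongs to its centre -/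

lemma norm_sub_smul_sq (x w : Plane) (d : ℝ) :
    ‖x - d • w‖ ^ 2 = ‖x‖ ^ 2 - 2 * d * ⟪x, w⟫ + d ^ 2 * ‖w‖ ^ 2 := by
  rw [norm_sub_sq_real, inner_smul_right, norm_smul, mul_pow, Real.norm_eq_abs, sq_abs]
  ring

/-- In this form the condition is a half-plane that visibly grows with $d$. -/
lemma norm_le_norm_sub_smul_iff {x w : Plane} {d : ℝ} (hd : 0 < d) :
    ‖x‖ ≤ ‖x - d • w‖ ↔ 2 * ⟪x, w⟫ ≤ d * ‖w‖ ^ 2 := by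
  rw [← sq_le_sq₀ (norm_nonneg _) (norm_nonneg _), norm_sub_smul_sq]
  constructor <;> intro h
  · nlinarith
  · nlinarith

/-- Relative to the centre of the cell `q`: the points of its disc that are not closer to the
centre of any cell in `A`, and not in the disc of any cell in `B`. -/
def localCell (R c : ℝ) (A B : Set (ℤ × ℤ)) (q : ℤ × ℤ) : Set Plane :=
  {x | ‖x‖ ≤ R ∧ (∀ p ∈ A, ‖x‖ ≤ ‖x - (2 * R * c) • latticePoint (p - q)‖) ∧
    ∀ p ∈ B, R < ‖x - (2 * R * c) • latticePoint (p - q)‖}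

lemma measurableSet_localCell (R c : ℝ) (A B : Set (ℤ × ℤ)) (q : ℤ × ℤ) :
    MeasurableSet (localCell R c A B q) := by
  have : localCell R c A B q = {x | ‖x‖ ≤ R} ∩
      ((⋂ p ∈ A, {x | ‖x‖ ≤ ‖x - (2 * R * c) • latticePoint (p - q)‖}) ∩
      ⋂ p ∈ B, {x | R < ‖x - (2 * R * c) • latticePoint (p - q)‖}) := by
    ext x; simp [localCell]
  rw [this]
  refine (measurableSet_le (by fun_prop) (by fun_prop)).inter (MeasurableSet.inter ?_ ?_)
  · exact MeasurableSet.biInter A.to_countable fun p _ =>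
      measurableSet_le (by fun_prop) (by fun_prop)
  · exact MeasurableSet.biInter B.to_countable fun p _ =>
      measurableSet_lt (by fun_prop) (by fun_prop)

lemma volume_localCell_ne_top (R c : ℝ) (A B : Set (ℤ × ℤ)) (q : ℤ × ℤ) :
    volume (localCell R c A B q) ≠ ⊤ :=
  measure_ne_top_of_subset (fun _ hx => mem_closedBall_zero_iff.2 hx.1)
    (measure_closedBall_lt_top (x := (0 : Plane)) (r := R)).ne

/-- The half-planes grow. For the discs, the squared distance from $x$ to the centre changes by
$4R(c'-c)\,(R(c+c')|w|^2-⟨x,w⟩)$. This is nonnegative, since $⟨x,w⟩\le R|w|\le R|w|^2$ and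
$c+c'\ge1$; `hq` rules out $w=0$. -/
lemma localCell_mono {R c c' : ℝ} (hR : 0 < R) (hc : 1 / 2 < c) (hcc : c ≤ c')
    {A B : Set (ℤ × ℤ)} {q : ℤ × ℤ} (hq : q ∉ B) :
    localCell R c A B q ⊆ localCell R c' A B q := by
  have hc0 : 0 < c := by linarith
  have hc0' : 0 < c' := by linarith
  rintro x ⟨hx, hA, hB⟩
  refine ⟨hx, fun p hp => ?_, fun p hp => ?_⟩
  · have h := hA p hp
    rw [norm_le_norm_sub_smul_iff (by positivity)] at h ⊢
    refine h.trans ?_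
    gcongr
  · have h := hB p hp
    have hw : 1 ≤ ‖latticePoint (p - q)‖ :=
      one_le_norm_latticePoint (sub_ne_zero.2 fun h => hq (h ▸ hp))
    set w := latticePoint (p - q)
    refine h.trans_le ?_
    rw [← sq_le_sq₀ (norm_nonneg _) (norm_nonneg _), norm_sub_smul_sq, norm_sub_smul_sq]
    have h1 : ⟪x, w⟫ ≤ R * ‖w‖ ^ 2 := by
      refine (real_inner_le_norm x w).trans ?_
      exact mul_le_mul hx (by nlinarith) (norm_nonneg _) hR.le
    have h2 : 0 ≤ R * (c' - c) * ((R * ‖w‖ ^ 2) * (c + c' - 1)) := by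
      have : 0 ≤ c + c' - 1 := by linarith
      have : 0 ≤ c' - c := by linarith
      positivity
    have h3 : 0 ≤ R * (c' - c) * (R * ‖w‖ ^ 2 - ⟪x, w⟫) :=
      mul_nonneg (mul_nonneg hR.le (by linarith)) (by linarith)
    nlinarith

/-- Close to `(R s) • u`, no point is in the disc around `(2 R c) • w`, where `w ≠ 0, u` is in the
lattice. -/
lemma lt_norm_sub_of_near {R c s : ℝ} (hR : 0 < R) (hc : 1 / 2 < c) (hs0 : 0 ≤ s) (hs1 : s ≤ 1)
    {u w y : Plane} (hu : ‖u‖ = 1) (hw : 1 ≤ ‖w‖) (hwu : 1 ≤ ‖w - u‖)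
    (hy : ‖y - (R * s) • u‖ < (√3 * c - 1) * R) : R < ‖y - (2 * R * c) • w‖ := by
  have h1 : ⟪u, w⟫ ≤ ‖w‖ ^ 2 / 2 := by
    have := norm_sub_sq_real w u
    rw [real_inner_comm, hu] at this
    nlinarith
  -- Replacing $⟨u,w⟩$ by $|w|^2/2$ and then $|w|^2$ by 1 leaves an excess of $R^2(s-c)^2$ over
  -- $3c^2R^2$. Equality is the height of an equilateral triangle of side $2Rc$.
  have h2 : √3 * c * R ≤ ‖(R * s) • u - (2 * R * c) • w‖ := by
    rw [← sq_le_sq₀ (by positivity) (norm_nonneg _), norm_sub_smul_sq, inner_smul_left, norm_smul,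
      hu, mul_pow, mul_pow, Real.sq_sqrt (by norm_num), Real.norm_of_nonneg (by positivity)]
    simp only [conj_trivial]
    have h3 : 0 ≤ R ^ 2 * s * c * (‖w‖ ^ 2 / 2 - ⟪u, w⟫) :=
      mul_nonneg (by positivity) (by linarith)
    have h4 : 0 ≤ R ^ 2 * c * ((‖w‖ ^ 2 - 1) * (4 * c - 2 * s)) :=
      mul_nonneg (by positivity) (mul_nonneg (by nlinarith) (by linarith))
    have h5 : 0 ≤ R ^ 2 * (s - c) ^ 2 := by positivity
    nlinarith
  have h6 := norm_sub_norm_le ((R * s) • u - (2 * R * c) • w) (y - (2 * R * c) • w)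
  rw [sub_sub_sub_cancel_right, norm_sub_rev _ y] at h6
  linarith

lemma half_lt_of_mem {c : ℝ} (hc : c ∈ Icc (1 / √3) 1) : 1 / 2 < c := by
  refine lt_of_lt_of_le ?_ hc.1
  rw [div_lt_div_iff_of_pos_left one_pos (by norm_num) (by positivity),
    Real.sqrt_lt' (by norm_num)]
  norm_num

/-- On the ray towards the neighbour $r$, the binding constraint of $r$ moves outwards strictly
between $c$ and $c'$. Near the chosen point of this gap no other cell interferes, because
$\sqrt3\,c'>1$ even when $c=1/\sqrt3$. -/
lemma exists_eventually_mem_localCell {R c c' : ℝ} (hR : 0 < R) (hc : c ∈ Icc (1 / √3) 1)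
    (hc' : c' ∈ Icc (1 / √3) 1) (hcc : c < c') {A B : Set (ℤ × ℤ)} (hAB : Disjoint A B)
    {q r : ℤ × ℤ} (hq : q ∉ B) (hr : r ∈ A ∪ B) (hqr : latticeNorm (r - q) = 1) :
    ∃ x, ∀ᶠ y in 𝓝 x, y ∈ localCell R c' A B q ∧ y ∉ localCell R c A B q := by
  have h2 := half_lt_of_mem hc
  have h2' := half_lt_of_mem hc'
  have hu : ‖latticePoint (r - q)‖ = 1 := by
    have := norm_latticePoint_sq (r - q)
    rw [hqr, Int.cast_one] at this
    exact (pow_eq_one_iff_of_nonneg (norm_nonneg _) two_ne_zero).1 this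
  have hε : 0 < (√3 * c' - 1) * R := by
    have h := hc.1.trans_lt hcc
    rw [div_lt_iff₀ (by positivity)] at h
    exact mul_pos (by linarith) hR
  set u := latticePoint (r - q)
  have near : ∀ {s}, 0 ≤ s → s ≤ 1 → ∀ᶠ y in 𝓝 ((R * s) • u), ∀ p, p ≠ q → p ≠ r →
      R < ‖y - (2 * R * c') • latticePoint (p - q)‖ := by
    intro s hs0 hs1
    filter_upwards [Metric.ball_mem_nhds _ hε] with y hy p hpq hpr
    rw [mem_ball_iff_norm] at hy
    refine lt_norm_sub_of_near hR h2' hs0 hs1 hu (one_le_norm_latticePoint (sub_ne_zero.2 hpq)) ?_ hy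
    rw [← latticePoint_sub, sub_sub_sub_cancel_right]
    exact one_le_norm_latticePoint (sub_ne_zero.2 hpr)
  have norm_lt : ∀ {s}, 0 ≤ s → s < 1 → ∀ᶠ y in 𝓝 ((R * s) • u), ‖y‖ < R := by
    intro s hs0 hs1
    refine (continuous_norm.tendsto _).eventually_lt_const ?_
    rw [norm_smul, hu, Real.norm_of_nonneg (by positivity)]
    nlinarith
  rcases hr with hr | hr
  · have hrB := disjoint_left.1 hAB hr
    have hin : ⟪(R * ((c + c') / 2)) • u, u⟫ = R * ((c + c') / 2) := by
      rw [inner_smul_left, real_inner_self_eq_norm_sq, hu]; simp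
    have hct : Tendsto (fun y => ⟪y, u⟫) (𝓝 ((R * ((c + c') / 2)) • u))
        (𝓝 (R * ((c + c') / 2))) := by
      have := (show Continuous fun y : Plane => ⟪y, u⟫ by fun_prop).tendsto
        ((R * ((c + c') / 2)) • u)
      rwa [hin] at this
    -- For $r\in A$ the bisectors cross the ray at $Rc$ and $Rc'$; the witness is their midpoint.
    refine ⟨(R * ((c + c') / 2)) • u, ?_⟩
    filter_upwards [near (s := (c + c') / 2) (by linarith) (by linarith [hc'.2]),
      norm_lt (s := (c + c') / 2) (by linarith) (by linarith [hc'.2]),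
      hct.eventually_lt_const (u := R * c') (by nlinarith),
      hct.eventually_const_lt (u := R * c) (by nlinarith)] with y hy hyR hlt hgt
    refine ⟨⟨hyR.le, fun p hp => ?_, fun p hp => hy p (by rintro rfl; exact hq hp)
      (by rintro rfl; exact hrB hp)⟩, fun h => ?_⟩
    · by_cases hpq : p = q
      · simp [hpq, latticePoint_zero]
      by_cases hpr : p = r
      · rw [hpr, norm_le_norm_sub_smul_iff (by positivity), hu]
        linarith
      exact hyR.le.trans (hy p hpq hpr).le
    · have := h.2.1 r hr
      rw [norm_le_norm_sub_smul_iff (by positivity), hu] at this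
      linarith
  · have hrA := disjoint_right.1 hAB hr
    have hdist : ∀ b, Tendsto (fun y => ‖y - (2 * R * b) • u‖) (𝓝 ((R * (c + c' - 1)) • u))
        (𝓝 (R * |c + c' - 1 - 2 * b|)) := by
      intro b
      have := (show Continuous fun y : Plane => ‖y - (2 * R * b) • u‖ by fun_prop).tendsto
        ((R * (c + c' - 1)) • u)
      rwa [← sub_smul, norm_smul, hu, mul_one, Real.norm_eq_abs,
        show R * (c + c' - 1) - 2 * R * b = R * (c + c' - 1 - 2 * b) by ring, abs_mul,
        abs_of_pos hR] at this
    -- For $r\in B$ the near edges of its disc lie at $R(2c-1)$ and $R(2c'-1)$; again the midpoint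
    -- is taken.
    refine ⟨(R * (c + c' - 1)) • u, ?_⟩
    filter_upwards [near (s := c + c' - 1) (by linarith) (by linarith [hc'.2, hc.2]),
      norm_lt (s := c + c' - 1) (by linarith) (by linarith [hc'.2, hc.2]),
      (hdist c).eventually_lt_const (u := R) (by
        have : |c + c' - 1 - 2 * c| < 1 := by rw [abs_lt]; constructor <;> linarith [hc'.2, hc.2]
        nlinarith),
      (hdist c').eventually_const_lt (u := R) (by
        have : 1 < |c + c' - 1 - 2 * c'| := by rw [lt_abs]; right; linarith
        nlinarith)] with y hy hyR hlt hgt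
    refine ⟨⟨hyR.le, fun p hp => ?_, fun p hp => ?_⟩, fun h => (h.2.2 r hr).not_gt hlt⟩
    · by_cases hpq : p = q
      · simp [hpq, latticePoint_zero]
      exact hyR.le.trans (hy p hpq (by rintro rfl; exact hrA hp)).le
    · by_cases hpr : p = r
      · rw [hpr]; exact hgt
      exact hy p (by rintro rfl; exact hq hp) hpr

lemma volume_localCell_lt {R c c' : ℝ} (hR : 0 < R) (hc : c ∈ Icc (1 / √3) 1)
    (hc' : c' ∈ Icc (1 / √3) 1) (hcc : c < c') {A B : Set (ℤ × ℤ)} (hAB : Disjoint A B)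
    {q r : ℤ × ℤ} (hq : q ∉ B) (hr : r ∈ A ∪ B) (hqr : latticeNorm (r - q) = 1) :
    volume (localCell R c A B q) < volume (localCell R c' A B q) := by
  obtain ⟨x, hx⟩ := exists_eventually_mem_localCell hR hc hc' hcc hAB hq hr hqr
  rw [← measure_inter_add_sdiff (localCell R c' A B q) (measurableSet_localCell R c A B q),
    inter_eq_self_of_subset_right (localCell_mono hR (half_lt_of_mem hc) hcc.le hq)]
  exact ENNReal.lt_add_right (volume_localCell_ne_top R c A B q) (Measure.measure_pos_of_mem_nhds _ hx).ne'

/-! ### Grids that repeat under a group of shifts -/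

/-- `E` is a fundamental domain for the translations by the lattice vectors in `H`. -/
structure IsWindow (H : AddSubgroup (ℤ × ℤ)) (d : ℝ) (E : Set Plane) : Prop where
  measurableSet : MeasurableSet E
  existsUnique : ∀ x, ∃! w : H, x + d • latticePoint w ∈ E

/-- The unfolding argument: the translates of $E$ tile the plane, and moving each piece back
reassembles $V$. -/
lemma IsWindow.tsum_volume {H : AddSubgroup (ℤ × ℤ)} {d : ℝ} {E : Set Plane}
    (hE : IsWindow H d E) {V : Set Plane} (hV : MeasurableSet V) :
    ∑' w : H, volume (E ∩ (fun x => x - d • latticePoint w) ⁻¹' V) = volume V := by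
  have h1 : ∀ w : H, volume (E ∩ (fun x => x - d • latticePoint w) ⁻¹' V) =
      volume ((fun x => x + d • latticePoint w) ⁻¹' E ∩ V) := by
    intro w
    rw [← measure_preimage_add_right volume (d • latticePoint (w : ℤ × ℤ))]
    congr 1
    ext x
    simp
  have hm : ∀ w : H, MeasurableSet ((fun x => x + d • latticePoint w) ⁻¹' E) := fun w =>
    hE.measurableSet.preimage (by fun_prop)
  simp only [h1]
  rw [← measure_iUnion, ← iUnion_inter]
  · congr 1
    refine inter_eq_self_of_subset_right fun x _ => mem_iUnion.2 ?_
    exact (hE.existsUnique x).exists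
  · intro w w' hww
    refine Set.disjoint_left.2 fun x hx hx' => hww ?_
    exact (hE.existsUnique x).unique hx.1 hx'.1
  · exact fun w => (hm w).inter hV

/-- A grid of SBSs: the SBS `i` stands in the cell `base i` and in its images under the shifts. -/
structure Layout (S : Type) where
  shifts : AddSubgroup (ℤ × ℤ)
  base : S → ℤ × ℤ
  base_inj : ∀ i j, base i - base j ∈ shifts → i = j
  four_le : ∀ w ∈ shifts, w ≠ 0 → 4 ≤ latticeNorm w
  neighbour : ∀ i, ∃ j, ∃ w ∈ shifts, latticeNorm (base j + w - base i) = 1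

namespace Layout

variable {S : Type} (L : Layout S) {R c c' : ℝ} {E E' : Set Plane}

/-- The cells of the SBSs in `Γ`. -/
def cells (Γ : Set S) : Set (ℤ × ℤ) := {q | ∃ i ∈ Γ, q - L.base i ∈ L.shifts}

/-- The coverage regions within a window. -/
def coverage (R c : ℝ) (E : Set Plane) (i : S) : Set Plane :=
  E ∩ ⋃ w : L.shifts, disc R c (L.base i + w)

lemma disjoint_cells (Γ : Set S) : Disjoint (L.cells Γᶜ) (L.cells Γ) := by
  rw [Set.disjoint_left]
  rintro q ⟨i, hi, hq⟩ ⟨j, hj, hq'⟩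
  have := L.shifts.sub_mem hq' hq
  rw [sub_sub_sub_cancel_left] at this
  exact hi (L.base_inj i j this ▸ hj)

lemma add_mem_cells_iff (Γ : Set S) {q w : ℤ × ℤ} (hw : w ∈ L.shifts) :
    q + w ∈ L.cells Γ ↔ q ∈ L.cells Γ := by
  simp only [cells, mem_ofPred_eq, add_sub_right_comm, L.shifts.add_mem_cancel_right hw]

lemma base_notMem_cells {Γ : Set S} {i : S} (hi : i ∉ Γ) : L.base i ∉ L.cells Γ := by
  rintro ⟨j, hj, h⟩
  exact hi (L.base_inj i j h ▸ hj)

/-- The points that are not closer to another uncached cell than to `q`, in the disc of `q` and in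
no cached disc. -/
def nearest (R c : ℝ) (Γ : Set S) (q : ℤ × ℤ) : Set Plane :=
  (fun x => x - (2 * R * c) • latticePoint q) ⁻¹' localCell R c (L.cells Γᶜ) (L.cells Γ) q

lemma mem_disc_iff {p : ℤ × ℤ} {x : Plane} :
    x ∈ disc R c p ↔ ‖x - (2 * R * c) • latticePoint p‖ ≤ R := by
  rw [disc, mem_closedBall_iff_norm, latticePoint]

variable {L} in
lemma mem_nearest_iff {Γ : Set S} {q : ℤ × ℤ} {x : Plane} :
    x ∈ L.nearest R c Γ q ↔ x ∈ disc R c q ∧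
      (∀ p ∈ L.cells Γᶜ, dist x ((2 * R * c) • latticePoint q) ≤
        dist x ((2 * R * c) • latticePoint p)) ∧ ∀ p ∈ L.cells Γ, x ∉ disc R c p := by
  simp only [nearest, localCell, mem_preimage, mem_ofPred_eq, mem_disc_iff, not_le, dist_eq_norm,
    latticePoint_sub, smul_sub, sub_sub_sub_cancel_right]

lemma measurableSet_nearest (Γ : Set S) (q : ℤ × ℤ) : MeasurableSet (L.nearest R c Γ q) :=
  (measurableSet_localCell ..).preimage (by fun_prop)

/-- Cached and uncached cells are both invariant under shifts, so $q+w$ and $q$ see the same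
configuration. -/
lemma nearest_add (Γ : Set S) (q : ℤ × ℤ) {w : ℤ × ℤ} (hw : w ∈ L.shifts) :
    L.nearest R c Γ (q + w) =
      (fun x => x - (2 * R * c) • latticePoint w) ⁻¹' L.nearest R c Γ q := by
  have h : localCell R c (L.cells Γᶜ) (L.cells Γ) (q + w) =
      localCell R c (L.cells Γᶜ) (L.cells Γ) q := by
    have key : ∀ (Γ : Set S) (f : ℤ × ℤ → Prop),
        (∀ p ∈ L.cells Γ, f (p - (q + w))) ↔ ∀ p ∈ L.cells Γ, f (p - q) := by
      intro Γ f
      constructor <;> intro h p hp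
      · have := h (p + w) ((L.add_mem_cells_iff Γ hw).2 hp)
        rwa [add_sub_add_right_eq_sub] at this
      · have := h (p + -w) ((L.add_mem_cells_iff Γ (L.shifts.neg_mem hw)).2 hp)
        rwa [show p + -w - q = p - (q + w) by abel] at this
    ext x
    simp only [localCell, mem_ofPred_eq]
    rw [key Γᶜ fun p => ‖x‖ ≤ ‖x - (2 * R * c) • latticePoint p‖,
      key Γ fun p => R < ‖x - (2 * R * c) • latticePoint p‖]
  ext x
  simp only [nearest, h, mem_preimage, latticePoint_add, smul_add, sub_sub,
    add_comm ((2 * R * c) • latticePoint q)]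

lemma uncovered_coverage (hd : 0 < 2 * R * c) (Γ : Set S) :
    uncovered (L.coverage R c E) Γ = E ∩ ⋃ q ∈ L.cells Γᶜ, L.nearest R c Γ q := by
  have mem_cov : ∀ x ∈ E, ∀ i, x ∈ L.coverage R c E i ↔
      ∃ q, q - L.base i ∈ L.shifts ∧ x ∈ disc R c q := by
    intro x hx i
    simp only [coverage, mem_inter_iff, hx, true_and, mem_iUnion]
    constructor
    · rintro ⟨w, hw⟩
      exact ⟨_, by simp, hw⟩
    · rintro ⟨q, hq, hxq⟩
      exact ⟨⟨_, hq⟩, by simpa using hxq⟩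
  ext x
  by_cases hx : x ∈ E
  swap
  · refine iff_of_false ?_ fun h => hx h.1
    rintro ⟨⟨i, hi⟩, -⟩
    exact hx hi.1
  simp only [uncovered, mem_ofPred_eq, mem_cov x hx, mem_inter_iff, hx, true_and, mem_iUnion₂,
    mem_nearest_iff, exists_prop]
  constructor
  · rintro ⟨⟨i, q, hq, hxq⟩, h⟩
    have hi : i ∉ Γ := fun hi => h i hi ⟨q, hq, hxq⟩
    -- Only finitely many centres lie within $R$ of $x$, so a nearest uncached one exists among
    -- them; centres farther than $R$ cannot beat it.
    obtain ⟨p, ⟨hp, hpR⟩, hmin⟩ := Set.exists_min_image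
      (L.cells Γᶜ ∩ {q | ‖x - (2 * R * c) • latticePoint q‖ ≤ R})
      (fun p => dist x ((2 * R * c) • latticePoint p))
      ((finite_norm_sub_latticePoint_le hd x R).subset inter_subset_right)
      ⟨q, ⟨i, hi, hq⟩, mem_disc_iff.1 hxq⟩
    refine ⟨p, hp, mem_disc_iff.2 hpR, fun p' hp' => ?_, ?_⟩
    · by_cases hR' : ‖x - (2 * R * c) • latticePoint p'‖ ≤ R
      · exact hmin p' ⟨hp', hR'⟩
      · rw [dist_eq_norm, dist_eq_norm]
        exact le_trans hpR (not_le.1 hR').le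
    · rintro p' ⟨j, hj, hp'⟩ hxp'
      exact h j hj ⟨p', hp', hxp'⟩
  · rintro ⟨q, ⟨i, hi, hq⟩, hxq, -, h⟩
    exact ⟨⟨i, q, hq, hxq⟩, fun j hj ⟨p, hp, hxp⟩ => h p ⟨j, hj, hp⟩ hxp⟩

lemma smul_latticePoint_ne (hd : 0 < 2 * R * c) {p q : ℤ × ℤ} (h : p ≠ q) :
    (2 * R * c) • latticePoint p ≠ (2 * R * c) • latticePoint q := by
  intro heq
  have h1 : latticePoint (p - q) = 0 := by
    rw [latticePoint_sub, sub_eq_zero]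
    exact smul_right_injective _ hd.ne' heq
  have := one_le_norm_latticePoint (sub_ne_zero.2 h)
  rw [h1, norm_zero] at this
  linarith

lemma volume_equidistant {a b : Plane} (h : a ≠ b) : volume {x | dist x a = dist x b} = 0 := by
  have : {x | dist x a = dist x b} = (AffineSubspace.perpBisector a b : Set Plane) := by
    ext x
    rw [SetLike.mem_coe, AffineSubspace.mem_perpBisector_iff_dist_eq]
    rfl
  rw [this]
  exact Measure.addHaar_affineSubspace _ _ (by rwa [Ne, AffineSubspace.perpBisector_eq_top])

/-- Ties between two centres occur only on their bisector. -/
lemma aedisjoint_nearest (hd : 0 < 2 * R * c) {Γ : Set S} {p q : ℤ × ℤ} (hp : p ∈ L.cells Γᶜ)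
    (hq : q ∈ L.cells Γᶜ) (h : p ≠ q) :
    AEDisjoint volume (L.nearest R c Γ p) (L.nearest R c Γ q) := by
  refine measure_mono_null (fun x hx => ?_) (volume_equidistant (smul_latticePoint_ne hd h))
  exact le_antisymm ((mem_nearest_iff.1 hx.1).2.1 q hq) ((mem_nearest_iff.1 hx.2).2.1 p hp)

lemma base_add_inj {i j : S} {w w' : L.shifts}
    (h : L.base i + (w : ℤ × ℤ) = L.base j + w') : (i, w) = (j, w') := by
  have hij : L.base i - L.base j = w' - w := by linear_combination h
  obtain rfl : i = j := L.base_inj i j (hij ▸ (w' - w).2)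
  rw [sub_self, eq_comm, sub_eq_zero] at hij
  rw [Subtype.ext hij]

/-! ### Areas in a layout and their dependence on the spacing. -/

/-- Partition by nearest uncached centre, then unfold over the shifts. The window disappears, and
$c$ remains only inside the local cells, where monotonicity is known. -/
lemma volume_uncovered [Countable S] (hd : 0 < 2 * R * c) (hE : IsWindow L.shifts (2 * R * c) E)
    (Γ : Set S) : volume (uncovered (L.coverage R c E) Γ) =
      ∑' i : ↥Γᶜ, volume (localCell R c (L.cells Γᶜ) (L.cells Γ) (L.base i)) := by
  have hU : ⋃ q ∈ L.cells Γᶜ, L.nearest R c Γ q =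
      ⋃ z : ↥Γᶜ × L.shifts, L.nearest R c Γ (L.base z.1 + z.2) := by
    ext x
    rw [mem_iUnion₂, mem_iUnion]
    constructor
    · rintro ⟨q, ⟨i, hi, hq⟩, hx⟩
      exact ⟨⟨⟨i, hi⟩, ⟨_, hq⟩⟩, by simpa using hx⟩
    · rintro ⟨⟨i, w⟩, hx⟩
      exact ⟨_, ⟨i, i.2, by simp⟩, hx⟩
  have hmem : ∀ z : ↥Γᶜ × L.shifts, L.base z.1 + (z.2 : ℤ × ℤ) ∈ L.cells Γᶜ := fun z =>
    ⟨z.1, z.1.2, by simp⟩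
  rw [L.uncovered_coverage hd, hU, inter_iUnion, measure_iUnion₀,
    ENNReal.tsum_prod (f := fun (i : ↥Γᶜ) (w : L.shifts) =>
      volume (E ∩ L.nearest R c Γ (L.base i + w)))]
  · refine tsum_congr fun i => ?_
    simp only [L.nearest_add Γ _ (Subtype.coe_prop _)]
    rw [hE.tsum_volume (L.measurableSet_nearest ..), nearest]
    simp only [sub_eq_add_neg]
    rw [measure_preimage_add_right]
  · intro z z' hz
    refine (L.aedisjoint_nearest hd (hmem z) (hmem z') fun h => hz ?_).mono
      inter_subset_right inter_subset_right
    have := L.base_add_inj h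
    simp only [Prod.ext_iff] at this ⊢
    exact ⟨Subtype.ext this.1, this.2⟩
  · exact fun z => (hE.measurableSet.inter (L.measurableSet_nearest ..)).nullMeasurableSet

lemma measurableSet_coverage (hE : MeasurableSet E) (i : S) :
    MeasurableSet (L.coverage R c E i) :=
  hE.inter (MeasurableSet.iUnion fun _ => measurableSet_closedBall)

/-- By `four_le`, the centres of two images of one SBS are at least $4Rc>2R$ apart. The discs are
therefore disjoint and unfold to one full disc. -/
lemma volume_coverage (hR : 0 < R) (hc : c ∈ Icc (1 / √3) 1)
    (hE : IsWindow L.shifts (2 * R * c) E) (i : S) :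
    volume (L.coverage R c E i) = volume (Metric.closedBall (0 : Plane) R) := by
  have hc2 := half_lt_of_mem hc
  have hdisc : ∀ w : L.shifts, disc R c (L.base i + w) =
      (fun x => x - (2 * R * c) • latticePoint w) ⁻¹' disc R c (L.base i) := by
    intro w
    ext x
    simp only [mem_preimage, mem_disc_iff, latticePoint_add, smul_add, sub_sub,
      add_comm ((2 * R * c) • latticePoint (L.base i))]
  rw [coverage, inter_iUnion, measure_iUnion]
  · simp only [hdisc]
    rw [hE.tsum_volume (V := disc R c (L.base i)) measurableSet_closedBall, disc,
      Measure.addHaar_closedBall_center]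
  · intro w w' hww
    refine Set.disjoint_left.2 fun x hx hx' => ?_
    have h1 := mem_disc_iff.1 hx.2
    have h2 := mem_disc_iff.1 hx'.2
    have h3 : ‖(2 * R * c) • latticePoint (w' - w)‖ ≤ R + R := by
      have := norm_sub_le (x - (2 * R * c) • latticePoint (L.base i + w))
        (x - (2 * R * c) • latticePoint (L.base i + w'))
      rw [sub_sub_sub_cancel_left, ← smul_sub, ← latticePoint_sub, add_sub_add_left_eq_sub] at this
      linarith
    have h4 : (4 : ℝ) ≤ ‖latticePoint (w' - w)‖ ^ 2 := by
      rw [norm_latticePoint_sq]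
      exact_mod_cast L.four_le _ (L.shifts.sub_mem w'.2 w.2)
        (sub_ne_zero.2 fun h => hww (Subtype.ext h.symm))
    have h5 : 2 ≤ ‖latticePoint (w' - w)‖ := by nlinarith [norm_nonneg (latticePoint (w' - w))]
    rw [norm_smul, Real.norm_of_nonneg (by positivity)] at h3
    have h6 : 0 < R * (2 * c - 1) := mul_pos hR (by linarith)
    nlinarith [mul_pos hR (show 0 < c by linarith)]
  · exact fun w => hE.measurableSet.inter measurableSet_closedBall

lemma volume_uncovered_ne_top [Finite S] (hR : 0 < R) (hc : c ∈ Icc (1 / √3) 1)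
    (hE : IsWindow L.shifts (2 * R * c) E) (Γ : Set S) :
    volume (uncovered (L.coverage R c E) Γ) ≠ ⊤ := by
  have := Fintype.ofFinite S
  have hsub : uncovered (L.coverage R c E) Γ ⊆ ⋃ i, L.coverage R c E i :=
    fun x hx => mem_iUnion.2 hx.1
  refine measure_ne_top_of_subset hsub ?_
  refine ((measure_iUnion_fintype_le _ _).trans_lt (ENNReal.sum_lt_top.2 fun j _ => ?_)).ne
  rw [L.volume_coverage hR hc hE]
  exact measure_closedBall_lt_top

lemma volume_uncovered_mono [Finite S] (hR : 0 < R) (hc : c ∈ Icc (1 / √3) 1)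
    (hc' : c' ∈ Icc (1 / √3) 1) (hE : IsWindow L.shifts (2 * R * c) E)
    (hE' : IsWindow L.shifts (2 * R * c') E') (hcc : c ≤ c') (Γ : Set S) :
    volume.real (uncovered (L.coverage R c E) Γ) ≤
      volume.real (uncovered (L.coverage R c' E') Γ) := by
  have h2 := half_lt_of_mem hc
  have h2' := half_lt_of_mem hc'
  refine ENNReal.toReal_mono (L.volume_uncovered_ne_top hR hc' hE' Γ) ?_
  rw [L.volume_uncovered (by positivity) hE, L.volume_uncovered (by positivity) hE']
  exact ENNReal.tsum_le_tsum fun i =>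
    measure_mono (localCell_mono hR h2 hcc (L.base_notMem_cells i.2))

lemma volume_uncovered_strictMono [Finite S] (hR : 0 < R) (hc : c ∈ Icc (1 / √3) 1)
    (hc' : c' ∈ Icc (1 / √3) 1) (hE : IsWindow L.shifts (2 * R * c) E)
    (hE' : IsWindow L.shifts (2 * R * c') E') (hcc : c < c') {Γ : Set S} (hΓ : ∃ i, i ∉ Γ) :
    volume.real (uncovered (L.coverage R c E) Γ) <
      volume.real (uncovered (L.coverage R c' E') Γ) := by
  have h2 := half_lt_of_mem hc
  have h2' := half_lt_of_mem hc'
  obtain ⟨i, hi⟩ := hΓ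
  have hfin := L.volume_uncovered_ne_top hR hc hE Γ
  refine (ENNReal.toReal_lt_toReal hfin (L.volume_uncovered_ne_top hR hc' hE' Γ)).2 ?_
  rw [L.volume_uncovered (by positivity) hE] at hfin ⊢
  rw [L.volume_uncovered (by positivity) hE']
  refine ENNReal.tsum_lt_tsum (i := ⟨i, hi⟩) hfin (fun i =>
    measure_mono (localCell_mono hR h2 hcc.le (L.base_notMem_cells i.2))) ?_
  obtain ⟨j, w, hw, hjw⟩ := L.neighbour i
  refine volume_localCell_lt hR hc hc' hcc (L.disjoint_cells Γ) (L.base_notMem_cells hi) ?_ hjw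
  -- A cached neighbour pushes its disc away, an uncached one its bisector; either gives a strict
  -- gain.
  by_cases hj : j ∈ Γ
  · exact Or.inr ⟨j, hj, by simpa using hw⟩
  · exact Or.inl ⟨j, hj, by simpa using hw⟩

/-- Discs whose centres have at least the distance of second neighbours overlap in a null set. -/
lemma volume_disc_inter_disc (hR : 0 < R) (hc : c ∈ Icc (1 / √3) 1) {p q : ℤ × ℤ}
    (h : 3 ≤ latticeNorm (p - q)) : volume (disc R c p ∩ disc R c q) = 0 := by
  have hd : 0 < 2 * R * c := by have := half_lt_of_mem hc; positivity
  have hpq : p ≠ q := by rintro rfl; simp [latticeNorm] at h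
  refine measure_mono_null (fun x hx => ?_) (volume_equidistant (smul_latticePoint_ne hd hpq))
  have h1 := mem_disc_iff.1 hx.1
  have h2 := mem_disc_iff.1 hx.2
  have h3 : √3 ≤ ‖latticePoint (p - q)‖ := by
    refine Real.sqrt_le_iff.2 ⟨norm_nonneg _, ?_⟩
    rw [norm_latticePoint_sq]
    exact_mod_cast h
  have h4 : 1 ≤ c * √3 := (div_le_iff₀ (by positivity)).1 hc.1
  have h5 : 2 * R ≤ ‖(2 * R * c) • latticePoint (p - q)‖ := by
    rw [norm_smul, Real.norm_of_nonneg hd.le]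
    calc 2 * R ≤ 2 * R * (c * √3) := le_mul_of_one_le_right (by positivity) h4
      _ = 2 * R * c * √3 := by ring
      _ ≤ _ := by gcongr
  have h6 := norm_sub_le (x - (2 * R * c) • latticePoint q) (x - (2 * R * c) • latticePoint p)
  rw [sub_sub_sub_cancel_left, ← smul_sub, ← latticePoint_sub] at h6
  -- Both distances are at most $R$ and their sum is at least $2R$, so they are equal.
  change dist x _ = dist x _
  rw [dist_eq_norm, dist_eq_norm]
  linarith

/-- A point covered by four SBSs lies in the discs of four distinct cells, two of which are at least
second neighbours. There are only countably many such pairs, each with a null intersection. -/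
lemma volume_simplestRegion_of_four_le (hR : 0 < R) (hc : c ∈ Icc (1 / √3) 1) {F : Finset S}
    (hF : 4 ≤ F.card) : volume (simplestRegion (L.coverage R c E) F) = 0 := by
  have hnull : volume (⋃ z : {z : (ℤ × ℤ) × (ℤ × ℤ) // 3 ≤ latticeNorm (z.1 - z.2)},
      disc R c z.1.1 ∩ disc R c z.1.2) = 0 :=
    measure_iUnion_null fun z => volume_disc_inter_disc hR hc z.2
  refine measure_mono_null (fun x hx => ?_) hnull
  obtain ⟨f⟩ : Nonempty (Fin 4 ↪ F) := Function.Embedding.nonempty_of_card_le (by simpa using hF)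
  have hcov : ∀ k, ∃ w : L.shifts, x ∈ disc R c (L.base (f k) + w) := fun k =>
    mem_iUnion.1 ((hx _).2 (f k).2).2
  choose w hw using hcov
  obtain ⟨i, j, hij⟩ := exists_three_le_latticeNorm (q := fun k => L.base (f k) + w k)
    (fun k k' h => f.injective (Subtype.ext (Prod.ext_iff.1 (L.base_add_inj h)).1))
  exact mem_iUnion.2 ⟨⟨(_, _), hij⟩, hw i, hw j⟩

end Layout

/-! ### The two forms of the hexagonal grid -/

lemma eq_smul_hexPoint_iff {d : ℝ} (hd : 0 < d) (x : Plane) (a b : ℝ) :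
    x = d • hexPoint a b ↔ a = x 0 / d - x 1 / (√3 * d) ∧ b = 2 * x 1 / (√3 * d) := by
  have h3 : 0 < √3 := by positivity
  constructor
  · rintro rfl
    simp only [hexPoint, PiLp.smul_apply, smul_eq_mul]
    simp
    constructor <;> field_simp <;> ring
  · rintro ⟨rfl, rfl⟩
    ext i
    fin_cases i <;> simp [hexPoint] <;> field_simp <;> ring

lemma mem_periodCell_iff {R c : ℝ} (hd : 0 < 2 * R * c) {N : ℕ} {x : Plane} :
    x ∈ periodCell R c N ↔
      x 0 / (2 * R * c) - x 1 / (√3 * (2 * R * c)) ∈ Ico (0 : ℝ) N ∧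
      2 * x 1 / (√3 * (2 * R * c)) ∈ Ico (0 : ℝ) N := by
  simp only [periodCell, mem_ofPred_eq, eq_smul_hexPoint_iff hd]
  constructor
  · rintro ⟨_, ha, _, hb, rfl, rfl⟩
    exact ⟨ha, hb⟩
  · rintro ⟨ha, hb⟩
    exact ⟨_, ha, _, hb, rfl, rfl⟩

lemma existsUnique_add_mul_mem_Ico {N : ℕ} (hN : 0 < N) (a : ℝ) :
    ∃! m : ℤ, a + N * m ∈ Ico (0 : ℝ) N := by
  have := existsUnique_add_zsmul_mem_Ico (a := (N : ℝ)) (by exact_mod_cast hN) a 0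
  simpa [mul_comm] using this

/-- The shifts by multiples of `N` cells in each coordinate. -/
def multiples (N : ℕ) : AddSubgroup (ℤ × ℤ) where
  carrier := {w | (N : ℤ) ∣ w.1 ∧ (N : ℤ) ∣ w.2}
  add_mem' h h' := ⟨dvd_add h.1 h'.1, dvd_add h.2 h'.2⟩
  zero_mem' := ⟨dvd_zero _, dvd_zero _⟩
  neg_mem' h := ⟨h.1.neg_right, h.2.neg_right⟩

lemma exists_eq_of_mem_multiples {N : ℕ} {w : ℤ × ℤ} (hw : w ∈ multiples N) :
    ∃ m n : ℤ, w = (N * m, N * n) :=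
  have ⟨⟨m, hm⟩, ⟨n, hn⟩⟩ := hw
  ⟨m, n, Prod.ext hm hn⟩

/-- In oblique coordinates a shift adds multiples of $N$ to each coordinate, so the claim reduces to
reduction modulo $N$ in each coordinate. -/
lemma isWindow_periodCell {R c : ℝ} (hd : 0 < 2 * R * c) {N : ℕ} (hN : 0 < N) :
    IsWindow (multiples N) (2 * R * c) (periodCell R c N) := by
  constructor
  · have : periodCell R c N =
        ((fun x : Plane => x 0 / (2 * R * c) - x 1 / (√3 * (2 * R * c))) ⁻¹' Ico (0 : ℝ) N) ∩
        ((fun x : Plane => 2 * x 1 / (√3 * (2 * R * c))) ⁻¹' Ico (0 : ℝ) N) := by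
      ext x
      exact mem_periodCell_iff hd
    rw [this]
    exact (measurableSet_Ico.preimage (by fun_prop)).inter (measurableSet_Ico.preimage (by fun_prop))
  · intro x
    have key : ∀ m n : ℤ, x + (2 * R * c) • latticePoint (N * m, N * n) ∈ periodCell R c N ↔
        x 0 / (2 * R * c) - x 1 / (√3 * (2 * R * c)) + N * m ∈ Ico (0 : ℝ) N ∧
        2 * x 1 / (√3 * (2 * R * c)) + N * n ∈ Ico (0 : ℝ) N := by
      intro m n
      rw [mem_periodCell_iff hd]
      have h3 : 0 < √3 := by positivity
      have hd' := hd.ne'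
      generalize 2 * R * c = d at hd' ⊢
      have h1 : (x + d • latticePoint (N * m, N * n)) 0 = x 0 + d * (N * m + N * n / 2) := by
        simp [latticePoint, hexPoint]
      have h2 : (x + d • latticePoint (N * m, N * n)) 1 = x 1 + d * (√3 / 2 * (N * n)) := by
        simp [latticePoint, hexPoint]
      rw [h1, h2]
      congr! 2 <;> field_simp <;> ring
    obtain ⟨m, hm, hm'⟩ := existsUnique_add_mul_mem_Ico hN
      (x 0 / (2 * R * c) - x 1 / (√3 * (2 * R * c)))
    obtain ⟨n, hn, hn'⟩ := existsUnique_add_mul_mem_Ico hN (2 * x 1 / (√3 * (2 * R * c)))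
    refine ⟨⟨(N * m, N * n), dvd_mul_right .., dvd_mul_right ..⟩, (key m n).2 ⟨hm, hn⟩, ?_⟩
    rintro ⟨w, hw⟩ h
    obtain ⟨m', n', rfl⟩ := exists_eq_of_mem_multiples hw
    obtain ⟨h1, h2⟩ := (key m' n').1 h
    obtain rfl := hm' m' h1
    obtain rfl := hn' n' h2
    rfl

lemma isWindow_univ (d : ℝ) : IsWindow ⊥ d univ :=
  ⟨MeasurableSet.univ, fun _ => ⟨0, mem_univ _, fun _ _ => Subsingleton.elim _ _⟩⟩

lemma latticeNorm_sub_eq_one_of_adjacent {p q : ℤ × ℤ} (h : Adjacent p q) :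
    latticeNorm (q - p) = 1 := by
  have h1 : ‖latticePoint (q - p)‖ = 1 := by
    rw [latticePoint_sub, ← dist_eq_norm, dist_comm]
    exact h
  have h2 := norm_latticePoint_sq (q - p)
  rw [h1, one_pow] at h2
  exact_mod_cast h2.symm

/-- A finite patch has no shifts. -/
def patchLayout (T : Finset (ℤ × ℤ)) (hT : ∀ p ∈ T, ∃ q ∈ T, Adjacent p q) :
    Layout {p // p ∈ T} where
  shifts := ⊥
  base p := p
  base_inj p q h := Subtype.ext (sub_eq_zero.1 h)
  four_le w hw h := absurd hw h
  neighbour p := by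
    obtain ⟨q, hq, h⟩ := hT p p.2
    exact ⟨⟨q, hq⟩, 0, zero_mem _, by simpa using latticeNorm_sub_eq_one_of_adjacent h⟩

lemma four_le_latticeNorm_of_mem_multiples {N : ℕ} (hN : 2 ≤ N) {w : ℤ × ℤ}
    (hw : w ∈ multiples N) (h : w ≠ 0) : 4 ≤ latticeNorm w := by
  obtain ⟨⟨m, hm⟩, ⟨n, hn⟩⟩ := hw
  have h0 : ((m, n) : ℤ × ℤ) ≠ 0 := by
    rintro h0
    simp only [Prod.mk_eq_zero] at h0
    exact h (Prod.ext (by simp [hm, h0.1]) (by simp [hn, h0.2]))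
  have h1 := one_le_latticeNorm h0
  have h2 : latticeNorm w = N ^ 2 * latticeNorm (m, n) := by
    simp only [latticeNorm, hm, hn]; ring
  have h3 : (2 : ℤ) ≤ N := by exact_mod_cast hN
  nlinarith

/-- In the periodic grid, the shifts are the multiples of the period. -/
def periodicLayout (N : ℕ) (hN : 2 ≤ N) : Layout (Fin N × Fin N) where
  shifts := multiples N
  base p := (((p.1 : ℕ) : ℤ), ((p.2 : ℕ) : ℤ))
  base_inj p q h := by
    have key : ∀ a b : Fin N, (N : ℤ) ∣ ((a : ℕ) : ℤ) - ((b : ℕ) : ℤ) → a = b := by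
      intro a b h
      have := Int.eq_zero_of_abs_lt_dvd h (by rw [abs_lt]; omega)
      exact Fin.ext (by omega)
    exact Prod.ext (key _ _ h.1) (key _ _ h.2)
  four_le w hw h := four_le_latticeNorm_of_mem_multiples hN hw h
  neighbour p := by
    obtain ⟨a, b⟩ := p
    by_cases h : (a : ℕ) + 1 < N
    · exact ⟨(⟨a + 1, h⟩, b), 0, zero_mem _, by simp [latticeNorm]⟩
    -- At the last value of the first coordinate, the neighbour wraps around to 0 in the next
    -- period.
    · refine ⟨(⟨0, by omega⟩, b), (N, 0), ⟨dvd_refl _, dvd_zero _⟩, ?_⟩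
      have : ((a : ℕ) : ℤ) = N - 1 := by omega
      simp [latticeNorm, this]

namespace HexGrid

/-- A grid as a layout. -/
def layout : (G : HexGrid) → Layout G.Station
  | .patch T _ hT => patchLayout T hT
  | .periodic N hN => periodicLayout N hN

/-- The region in which areas are measured. -/
def window (R c : ℝ) : HexGrid → Set Plane
  | .patch _ _ _ => univ
  | .periodic N _ => periodCell R c N

lemma isWindow_window (G : HexGrid) {R c : ℝ} (hd : 0 < 2 * R * c) :
    IsWindow G.layout.shifts (2 * R * c) (G.window R c) :=
  match G with
  | .patch _ _ _ => isWindow_univ _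
  | .periodic _ hN => isWindow_periodCell hd (by omega)

lemma coverage_eq_layout_coverage (G : HexGrid) (R c : ℝ) :
    G.coverage R c = G.layout.coverage R c (G.window R c) := by
  funext p
  ext x
  match G, p with
  | .patch T _ hT, p =>
    constructor
    · intro h
      refine ⟨mem_univ _, mem_iUnion.2 ⟨0, ?_⟩⟩
      have h0 : (patchLayout T hT).base p + (0 : ℤ × ℤ) = p.1 := add_zero _
      change x ∈ disc R c ((patchLayout T hT).base p + (0 : ℤ × ℤ))
      rwa [h0]
    · rintro ⟨-, h⟩
      obtain ⟨⟨w, hw⟩, h⟩ := mem_iUnion.1 h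
      obtain rfl : w = 0 := hw
      have h0 : (patchLayout T hT).base p + (0 : ℤ × ℤ) = p.1 := add_zero _
      change x ∈ disc R c ((patchLayout T hT).base p + (0 : ℤ × ℤ)) at h
      rwa [h0] at h
  | .periodic N hN, p =>
    refine and_congr_right fun _ => ?_
    rw [mem_iUnion, mem_iUnion]
    constructor
    · rintro ⟨k, h⟩
      exact ⟨⟨(N * k.1, N * k.2), dvd_mul_right .., dvd_mul_right ..⟩, h⟩
    · rintro ⟨⟨w, hw⟩, h⟩
      obtain ⟨m, n, rfl⟩ := exists_eq_of_mem_multiples hw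
      exact ⟨(m, n), h⟩

instance (G : HexGrid) : Nonempty G.Station :=
  match G with
  | .patch _ ⟨p, hp⟩ _ => ⟨⟨p, hp⟩⟩
  | .periodic _ hN => ⟨(⟨0, by omega⟩, ⟨0, by omega⟩)⟩

end HexGrid

end SmallCell

end

theorem proposition3 (G : SmallCell.HexGrid) (R : ℝ) (hR : 0 < R)
    (C : SmallCell.Catalogue) (P : SmallCell.Params C)
    (γ : SmallCell.Allocation C G.Station) (t : ℕ)
    (hβ₁ : 0 < P.β₁) (hβ₂ : 0 ≤ P.β₂) (hβ₃ : P.β₃ = 0)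
    (hpop : ∀ l k, 0 ≤ P.popularity t l k) (hpop_sum : 0 < SmallCell.totalPopularity P t)
    (ρ : ℝ) (hρ : 0 < ρ) (huniform : ∀ x, P.density t x = ρ) :
    -- no region is covered by four or more SBSs
    (∀ c ∈ Set.Icc (1 / √3) 1, ∀ F : Finset G.Station, 4 ≤ F.card →
      MeasureTheory.volume (SmallCell.simplestRegion (G.coverage R c) F) = 0) ∧
    -- a denser grid has a greater overlapping percentage
    StrictAntiOn (fun c => SmallCell.overlapPercentage (G.coverage R c)) (Set.Icc (1 / √3) 1) ∧
    -- the average delay decreases as `c` decreases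
    MonotoneOn (fun c => SmallCell.averageDelay P (G.coverage R c) γ t) (Set.Icc (1 / √3) 1) ∧
    -- the average delay decreases as the overlapping percentage increases
    (∀ c ∈ Set.Icc (1 / √3) 1, ∀ c' ∈ Set.Icc (1 / √3) 1,
      SmallCell.overlapPercentage (G.coverage R c) <
        SmallCell.overlapPercentage (G.coverage R c') →
      SmallCell.averageDelay P (G.coverage R c') γ t ≤
        SmallCell.averageDelay P (G.coverage R c) γ t) ∧
    -- strictly so, unless all SBSs have all the requested blocks in their caches
    ((∃ i l k n, 0 < P.popularity t l k ∧ γ t i l k n = false) →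
      StrictMonoOn (fun c => SmallCell.averageDelay P (G.coverage R c) γ t)
        (Set.Icc (1 / √3) 1) ∧
      ∀ c ∈ Set.Icc (1 / √3) 1, ∀ c' ∈ Set.Icc (1 / √3) 1,
        SmallCell.overlapPercentage (G.coverage R c) <
          SmallCell.overlapPercentage (G.coverage R c') →
        SmallCell.averageDelay P (G.coverage R c') γ t <
          SmallCell.averageDelay P (G.coverage R c) γ t) := by
  have hd : ∀ c ∈ Set.Icc (1 / √3) 1, 0 < 2 * R * c := fun c hc => by
    have := SmallCell.half_lt_of_mem hc
    positivity
  have hE := fun c hc => G.isWindow_window (hd c hc)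
  obtain ⟨hO, hD, hD'⟩ := SmallCell.delay_of_uncovered_mono (P := P) (t := t)
    (I := Set.Icc (1 / √3) 1) (cov := fun c => G.coverage R c)
    (a := MeasureTheory.volume.real (Metric.closedBall (0 : SmallCell.Plane) R))
    (fun c hc i => by
      rw [G.coverage_eq_layout_coverage]
      exact G.layout.measurableSet_coverage (hE c hc).measurableSet i)
    (fun c hc i => by
      rw [G.coverage_eq_layout_coverage, G.layout.volume_coverage hR hc (hE c hc)]
      exact MeasureTheory.measure_closedBall_lt_top.ne)
    (fun c hc i => by
      rw [G.coverage_eq_layout_coverage, MeasureTheory.measureReal_def,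
        G.layout.volume_coverage hR hc (hE c hc), MeasureTheory.measureReal_def])
    (ENNReal.toReal_pos (Metric.measure_closedBall_pos _ _ hR).ne'
      MeasureTheory.measure_closedBall_lt_top.ne)
    (fun Γ c hc c' hc' hcc => by
      simp only [G.coverage_eq_layout_coverage]
      exact G.layout.volume_uncovered_mono hR hc hc' (hE c hc) (hE c' hc') hcc Γ)
    (fun Γ hΓ c hc c' hc' hcc => by
      simp only [G.coverage_eq_layout_coverage]
      exact G.layout.volume_uncovered_strictMono hR hc hc' (hE c hc) (hE c' hc') hcc hΓ)
    γ hβ₁ hβ₃ hpop hpop_sum hρ huniform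
  refine ⟨fun c hc F hF => ?_, hO, hD, fun c hc c' hc' h => ?_, fun hγ => ⟨hD' hγ, ?_⟩⟩
  · rw [G.coverage_eq_layout_coverage]
    exact G.layout.volume_simplestRegion_of_four_le hR hc hF
  -- Strict antitonicity of $O$ turns a greater overlap into a smaller $c$.
  · exact hD hc' hc ((hO.lt_iff_gt hc hc').1 h).le
  · exact fun c hc c' hc' h => hD' hγ hc' hc ((hO.lt_iff_gt hc hc').1 h)
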